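/- Let $n\ge 0$. A matching of length $n$ is a partition of $\{1,\dots,2n\}$ into arcs $[a_i,b_i]$, $a_i<b_i$, $a_1<\dots<a_n$. It is a *Stoimenow matching* if it has no two nested arcs with adjacent openers ($[i,\ell],[i+1,k]$ with $k<\ell$) and no two nested arcs with adjacent closers ($[k,j+1],[\ell,j]$ with $k<\ell$). Let $\mathcal M_n(P_2)$ be the set of Stoimenow matchings of length $n$ in which no four arcs form a submatching order-isomorphic to $P_2=\{[1,3],[2,5],[4,7],[6,8]\}$. An *ascent* of an integer sequence $\alpha=(\alpha_1,\dots,\alpha_n)$ is an index $1\le i<n$ with $\alpha_i<\alpha_{i+1}$; $\alpha$ is an *ascent sequence* if $\alpha_1=0$ and $0\le\alpha_i\le 1+\mathrm{asc}(\alpha_1,\dots,\alpha_{i-1})$ for $2\le i\le n$, where $\mathrm{asc}$ is the number of ascents. A permutation $\pi$ of $\{1,\dots,n\}$ is a *Fishburn permutation* if there are no $i,j$ with $j>i+1$ and $\pi_j+1=\pi_i<\pi_{i+1}$. A word contains a pattern if it has a subsequence order-isomorphic to it, and avoids it otherwise. Let $\mathcal F_n(3142)$ be the set of $3142$-avoiding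 Fishburn permutations of length $n$. Define the following maps. * $\Omega$ sends a matching to the poset on $\{p_1,\dots,p_n\}$ with $p_i<p_j$ iff $b_i<a_j$. Such a poset is $(\mathbf{2+2})$-free, so its different strict down-sets form a chain $D_0\subsetneq D_1\subsetneq\cdots$, and $x$ is said to have level $i$ if its strict down-set $D(x)$ is $D_i$. * $\mathcal O$ sends a $(\mathbf{2+2})$-free poset $P$ with $n$ elements to a sequence of length $n$, recursively: the last entry is the least level $i$ containing a maximal element of $P$. Let $y$ be a maximal element of level $i$ (any two such elements are interchangeable). If $y$ is the only element of its level and $i$ is not the highest level, first delete all relations $u<v$ with $u\in D_{i+1}\setminus D_i$. Then remove $y$; the first $n-1$ entries are $\mathcal O$ of the poset that is left. Put $\Psi=\mathcal O\circ\Omega$. * For $1\le j\le n-1$ let $M(\alpha,j)$ arise from $\alpha$ by adding $1$ to every $\alpha_i$ with $i<j$ and $\alpha_i\ge\alpha_{j+1}$. If $j_1<\dots<j_k$ are the ascents of $\alpha$, then $\Delta(\alpha)$ is obtained from $\alpha$ by applying $M(\cdot,j_1)$, then $M(\cdot,j_2)$, ..., then $M(\cdot,j_k)$. * $\mathcal T(\alpha)$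 is the permutation obtained by sorting the columns $\binom{\alpha_i}{i}$, $1\le i\le n$, in weakly increasing order of the top entries and, among equal top entries, in decreasing order of the bottom entries, and reading the bottom row. **Theorem.** For every $n\ge 0$, the map $\Upsilon=\mathcal T\circ\Delta\circ\Psi$ restricts to a bijection from $\mathcal M_n(P_2)$ onto $\mathcal F_n(3142)$. Moreover, an ascent sequence of length $n$ avoids $0101$ if and only if it avoids $101$, and $\Delta(\alpha)=\alpha$ for every such ascent sequence $\alpha$. -/

import Mathlib

namespace Fishburn

/-! ### Matchings -/

/-- A matching on the `2 * n` points `0 < 1 < ⋯ < 2 * n - 1`, i.e. a partition of them into `n` arcs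
`[opener i, closer i]`. The arcs are indexed by increasing opener, so that every partition into
arcs is represented exactly once. -/
structure Matching (n : ℕ) where
  opener : Fin n → Fin (2 * n)
  closer : Fin n → Fin (2 * n)
  opener_strictMono : StrictMono opener
  opener_lt_closer : ∀ i, opener i < closer i
  endpoints_bijective : Function.Bijective (Sum.elim opener closer)

namespace Matching

/-- No Type I arcs (two nested arcs with adjacent openers) and no Type II arcs (two nested arcs
with adjacent closers). -/
def IsStoimenow {n : ℕ} (M : Matching n) : Prop :=
  (∀ i j, (M.opener j : ℕ) = M.opener i + 1 → ¬ M.closer j < M.closer i) ∧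
  (∀ i j, (M.closer i : ℕ) = M.closer j + 1 → ¬ M.opener i < M.opener j)

/-- `M` contains the pattern `P`: some set of arcs of `M`, chosen by `f`, forms a submatching
isomorphic to `P`, i.e. its endpoints are in the same relative order as those of `P`. -/
def Contains {n k : ℕ} (M : Matching n) (P : Matching k) : Prop :=
  ∃ f : Fin k ↪o Fin n, ∀ i j : Fin k,
    (P.closer i < P.closer j ↔ M.closer (f i) < M.closer (f j)) ∧
    (P.opener i < P.closer j ↔ M.opener (f i) < M.closer (f j))

/-- The pattern `P₂`, the 4-chain with arcs `[0, 2], [1, 4], [3, 6], [5, 7]`. -/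
def patternP2 : Matching 4 where
  opener := ![0, 1, 3, 5]
  closer := ![2, 4, 6, 7]
  opener_strictMono := by decide
  opener_lt_closer := by decide
  endpoints_bijective := by decide

end Matching

/-! ### Finite posets and the map from posets to integer sequences -/

/-- A finite poset, given by its set of elements `carrier` and its strict order `lt`. -/
structure FinPoset (V : Type) where
  carrier : Finset V
  lt : V → V → Prop
  decLt : DecidableRel lt
  mem_of_lt : ∀ {x y}, lt x y → x ∈ carrier ∧ y ∈ carrier
  irrefl : ∀ x, ¬ lt x x
  trans : ∀ {x y z}, lt x y → lt y z → lt x z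

attribute [instance] FinPoset.decLt

namespace FinPoset

variable {V : Type} [LinearOrder V]

/-- The strict down-set `D(x)`, the set of predecessors of `x`. -/
def down (P : FinPoset V) (x : V) : Finset V := P.carrier.filter fun z => P.lt z x

/-- The level of `x`: the number of different sets `D(z)`, `z ∈ P`, that are properly contained
in `D(x)`. If `P` is (2+2)-free, its sets of predecessors form a chain `D_0 ⊂ D_1 ⊂ ⋯`,
and `x` has level `i` if and only if `D(x) = D_i`. -/
def level (P : FinPoset V) (x : V) : ℕ :=
  ((P.carrier.image P.down).filter fun d => d ⊂ P.down x).card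

/-- The `i`-th level `L_i` of `P`. -/
def levelSet (P : FinPoset V) (i : ℕ) : Finset V := P.carrier.filter fun x => P.level x = i

/-- The maximal elements of `P`. -/
def maximals (P : FinPoset V) : Finset V :=
  P.carrier.filter fun x => ∀ z ∈ P.carrier, ¬ P.lt x z

/-- `ℓ⋆(P)`, the least level that contains a maximal element (`0` for the empty poset). -/
def minMaxLevel (P : FinPoset V) : ℕ := (P.maximals.image P.level).min.untopD 0

/-- For `y` on level `i`: the set `D_{i+1} \ D_i` if `y` is the only element of its level, and the
empty set otherwise. It is also empty if level `i` is the highest one. -/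
def freed (P : FinPoset V) (y : V) : Finset V :=
  if P.levelSet (P.level y) = {y} then
    (P.levelSet (P.level y + 1)).biUnion fun z => P.down z \ P.down y
  else ∅

/-- Remove `y`, after deleting all the relations `u < v` with `u ∈ freed y`. -/
def removeAt (P : FinPoset V) (y : V) : FinPoset V where
  carrier := P.carrier.erase y
  lt u v := P.lt u v ∧ u ∉ P.freed y ∧ u ≠ y ∧ v ≠ y
  decLt := fun _ _ => inferInstance
  mem_of_lt h :=
    ⟨Finset.mem_erase.2 ⟨h.2.2.1, (P.mem_of_lt h.1).1⟩,
      Finset.mem_erase.2 ⟨h.2.2.2, (P.mem_of_lt h.1).2⟩⟩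
  irrefl x h := P.irrefl x h.1
  trans h₁ h₂ := ⟨P.trans h₁.1 h₂.1, h₁.2.1, h₁.2.2.1, h₂.2.2.2⟩

/-- One step of the decomposition of a (2+2)-free poset: remove a maximal element of level
`ℓ⋆(P)`. In a (2+2)-free poset these elements have the same predecessors and the same (empty) set
of successors, so that they are interchangeable; we take the one with the smallest label. -/
def remove (P : FinPoset V) : FinPoset V :=
  match (P.maximals.filter fun x => P.level x = P.minMaxLevel).min with
  | ⊤ => P
  | (y : V) => P.removeAt y

/-- The map `𝒪` from (2+2)-free posets with `n` elements to ascent sequences of length `n`: the last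
entry is `ℓ⋆(P)`, the one before it is `ℓ⋆` of the poset that is left after one removal,
and so on. -/
def toSeq (P : FinPoset V) (n : ℕ) (_hn : P.carrier.card = n) : Fin n → ℕ :=
  fun k => (remove^[n - 1 - k] P).minMaxLevel

end FinPoset

namespace Matching

/-- The poset `Ω(M)` on the arcs of `M`: `p_i < p_j` if the `i`-th arc closes before the `j`-th
arc opens. -/
def toPoset {n : ℕ} (M : Matching n) : FinPoset (Fin n) where
  carrier := Finset.univ
  lt i j := M.closer i < M.opener j
  decLt := fun _ _ => inferInstance
  mem_of_lt _ := ⟨Finset.mem_univ _, Finset.mem_univ _⟩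
  irrefl i h := lt_asymm h (M.opener_lt_closer i)
  trans {_ j _} h₁ h₂ := (h₁.trans (M.opener_lt_closer j)).trans h₂

/-- `Ψ = 𝒪 ∘ Ω`, from matchings to integer sequences. -/
def Psi {n : ℕ} (M : Matching n) : Fin n → ℕ :=
  M.toPoset.toSeq n (Finset.card_fin n)

end Matching

/-! ### Sequences -/

/-- The word `w` contains the pattern `p`: some subsequence of `w` is order-isomorphic to `p`. -/
def ContainsPattern {α : Type} [LinearOrder α] {n k : ℕ} (w : Fin n → α) (p : Fin k → ℕ) : Prop :=
  ∃ f : Fin k ↪o Fin n, ∀ i j : Fin k, p i < p j ↔ w (f i) < w (f j)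

/-- `j` is an ascent of `α` (positions are counted from `0`). -/
def IsAscent {n : ℕ} (α : Fin n → ℕ) (j : ℕ) : Prop :=
  ∃ h : j + 1 < n, α ⟨j, Nat.lt_of_succ_lt h⟩ < α ⟨j + 1, h⟩

instance {n : ℕ} (α : Fin n → ℕ) : DecidablePred (IsAscent α) :=
  fun j => inferInstanceAs
    (Decidable (∃ h : j + 1 < n, α ⟨j, Nat.lt_of_succ_lt h⟩ < α ⟨j + 1, h⟩))

/-- The number of ascents of the prefix of `α` formed by its first `m` entries. -/
def ascPrefix {n : ℕ} (α : Fin n → ℕ) (m : ℕ) : ℕ :=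
  ((Finset.range n).filter fun j => j + 1 < m ∧ IsAscent α j).card

/-- Ascent sequences: the first entry is `0`, and every other entry is at most one more than the
number of ascents of the prefix before it. -/
def IsAscentSeq {n : ℕ} (α : Fin n → ℕ) : Prop :=
  ∀ i : Fin n, ((i : ℕ) = 0 → α i = 0) ∧ ((i : ℕ) ≠ 0 → α i ≤ 1 + ascPrefix α i)

/-- `M(α, j)`: add `1` to the entries to the left of position `j` that are at least
`α (j + 1)`. -/
def modifyAt {n : ℕ} (α : Fin n → ℕ) (j : ℕ) : Fin n → ℕ :=
  if h : j + 1 < n then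
    fun i => if (i : ℕ) < j ∧ α ⟨j + 1, h⟩ ≤ α i then α i + 1 else α i
  else α

/-- `Asc(α)`: the ascents of `α` in increasing order. -/
def ascList {n : ℕ} (α : Fin n → ℕ) : List ℕ :=
  (List.range n).filter fun j => IsAscent α j

/-- The modification map `Δ(α) = M(α, Asc(α))`. -/
def Delta {n : ℕ} (α : Fin n → ℕ) : Fin n → ℕ :=
  (ascList α).foldl modifyAt α

/-! ### Permutations

A permutation `π` of `Fin n` is read as the word `π 0, π 1, …, π (n - 1)`. -/

/-- The transposition `𝒯`: flip the biword with rows `id` and `α`, so that its columns become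
`(α i, i)`, and sort the columns by their top entries in weakly increasing order and, where the
top entries are equal, by their bottom entries in decreasing order; the bottom row is `𝒯(α)`. -/
def transposition {n : ℕ} (α : Fin n → ℕ) : Equiv.Perm (Fin n) :=
  Tuple.sort fun i => toLex (α i, OrderDual.toDual i)

/-- Avoidance of the Fishburn pattern: there are no positions `i`, `j` with `j > i + 1` and
`π_j + 1 = π_i < π_{i+1}`. -/
def IsFishburn {n : ℕ} (π : Equiv.Perm (Fin n)) : Prop :=
  ¬ ∃ i i' j : Fin n, (i' : ℕ) = i + 1 ∧ i' < j ∧ (π j : ℕ) + 1 = π i ∧ π i < π i'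

/-- `Υ = 𝒯 ∘ Δ ∘ Ψ`, from matchings to permutations. -/
def Upsilon {n : ℕ} (M : Matching n) : Equiv.Perm (Fin n) :=
  transposition (Delta M.Psi)

end Fishburn

/-!
In a `P₂`-avoiding Stoimenow matching `M`, cut the points into blocks between each closer and an
opener that follows it immediately, and read an arc as the interval from the block of its opener
to the block of its closer. The families that arise are exactly those in which any two intervals
are nested or disjoint and every point `j` up to the maximum occurs as the interval `[j, j]`, and
they determine `M`. The poset `Ω(M)` is the interval order of this family. The point intervals
make the level of an element its left endpoint, so that `𝒪` always removes an interval whose right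
endpoint is largest and whose left endpoint is then smallest, and never has to delete further
relations. Thus `Ψ(M)` lists the left endpoints sorted by right endpoints. The sequences obtained
are the restricted growth functions that avoid `101`, and the right endpoints are recovered as the
prefix maxima.

Ascent tops of a restricted growth function that avoids `0101` are new maxima, so `Δ` fixes it.
Finally, the maximal descending runs of `𝒯(α)` are the level sets of such a function `α`, so that
`α` is recovered from `𝒯(α)` by numbering the runs.
-/

namespace Fishburn

/-! ### Counting and chains -/

theorem exists_count_eq_of_lt_count {p : ℕ → Prop} [DecidablePred p] {v m : ℕ}
    (hv : v < Nat.count p m) : ∃ k < m, p k ∧ Nat.count p k = v := by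
  induction m with
  | zero => exact absurd hv (Nat.not_lt_zero v)
  | succ m ih =>
    rcases lt_or_ge v (Nat.count p m) with h | h
    · obtain ⟨k, hk, hkv⟩ := ih h
      exact ⟨k, Nat.lt_succ_of_lt hk, hkv⟩
    · rw [Nat.count_succ] at hv
      split_ifs at hv with hm
      · exact ⟨m, Nat.lt_succ_self m, hm, by omega⟩
      · omega

theorem exists_and_not_succ {p : ℕ → Prop} {a b : ℕ} (hab : a ≤ b) (ha : p a) (hb : ¬ p b) :
    ∃ c, a ≤ c ∧ c < b ∧ p c ∧ ¬ p (c + 1) := by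
  by_contra! h
  refine hb (Nat.le_induction (P := fun c _ => c ≤ b → p c) (fun _ => ha) ?_ b hab le_rfl)
  exact fun c hac ih hcb => h c hac hcb (ih (Nat.le_of_succ_le hcb))

/-! ### Patterns -/

section Patterns

variable {α : Type} [LinearOrder α] {n : ℕ} (w : Fin n → α)

theorem containsPattern_101_iff :
    ContainsPattern w ![1, 0, 1] ↔ ∃ p q s, p < q ∧ q < s ∧ w p = w s ∧ w q < w p := by
  constructor
  · rintro ⟨f, hf⟩
    have hle : w (f 0) ≤ w (f 2) := not_lt.1 (mt (hf 2 0).2 (by decide))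
    have hge : w (f 2) ≤ w (f 0) := not_lt.1 (mt (hf 0 2).2 (by decide))
    exact ⟨f 0, f 1, f 2, f.strictMono (by decide), f.strictMono (by decide), hle.antisymm hge,
      (hf 1 0).1 (by decide)⟩
  · rintro ⟨p, q, s, hpq, hqs, hps, hlt⟩
    refine ⟨OrderEmbedding.ofStrictMono ![p, q, s] (by simp [hpq, hqs]), fun i j => ?_⟩
    rw [hps] at hlt
    fin_cases i <;> fin_cases j <;> simp [hps, hlt, hlt.le]

theorem containsPattern_0101_iff :
    ContainsPattern w ![0, 1, 0, 1] ↔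
      ∃ o p q s, o < p ∧ p < q ∧ q < s ∧ w o = w q ∧ w p = w s ∧ w q < w p := by
  constructor
  · rintro ⟨f, hf⟩
    have hle : w (f 0) ≤ w (f 2) := not_lt.1 (mt (hf 2 0).2 (by decide))
    have hge : w (f 2) ≤ w (f 0) := not_lt.1 (mt (hf 0 2).2 (by decide))
    have hle' : w (f 1) ≤ w (f 3) := not_lt.1 (mt (hf 3 1).2 (by decide))
    have hge' : w (f 3) ≤ w (f 1) := not_lt.1 (mt (hf 1 3).2 (by decide))
    exact ⟨f 0, f 1, f 2, f 3, f.strictMono (by decide), f.strictMono (by decide),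
      f.strictMono (by decide), hle.antisymm hge, hle'.antisymm hge', (hf 2 1).1 (by decide)⟩
  · rintro ⟨o, p, q, s, hop, hpq, hqs, hoq, hps, hlt⟩
    refine ⟨OrderEmbedding.ofStrictMono ![o, p, q, s] (by simp [hop, hpq, hqs]), fun i j => ?_⟩
    rw [hps] at hlt
    fin_cases i <;> fin_cases j <;> simp [hoq, hps, hlt, hlt.le]

theorem containsPattern_101_of_0101 (h : ContainsPattern w ![0, 1, 0, 1]) :
    ContainsPattern w ![1, 0, 1] := by
  obtain ⟨_, p, q, s, -, hpq, hqs, -, hps, hlt⟩ := (containsPattern_0101_iff w).1 h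
  exact (containsPattern_101_iff w).2 ⟨p, q, s, hpq, hqs, hps, hlt⟩

theorem containsPattern_3142_iff :
    ContainsPattern w ![3, 1, 4, 2] ↔
      ∃ a b c d, a < b ∧ b < c ∧ c < d ∧ w b < w d ∧ w d < w a ∧ w a < w c := by
  constructor
  · rintro ⟨f, hf⟩
    exact ⟨f 0, f 1, f 2, f 3, f.strictMono (by decide), f.strictMono (by decide),
      f.strictMono (by decide), (hf 1 3).1 (by decide), (hf 3 0).1 (by decide),
      (hf 0 2).1 (by decide)⟩
  · rintro ⟨a, b, c, d, hab, hbc, hcd, hbd, hda, hac⟩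
    refine ⟨OrderEmbedding.ofStrictMono ![a, b, c, d] (by simp [hab, hbc, hcd]), fun i j => ?_⟩
    have hba := hbd.trans hda
    have hdc := hda.trans hac
    have hbc := hba.trans hac
    fin_cases i <;> fin_cases j <;>
      simp [hbd, hda, hac, hba, hdc, hbc, hbd.le, hda.le, hac.le, hba.le, hdc.le, hbc.le]

end Patterns

/-! ### Restricted growth functions -/

/-- Every value smaller than `α i` occurs before position `i`: the condition that a restricted
growth function satisfies at the single position `i`. -/
def IsRGFAt {n : ℕ} (α : Fin n → ℕ) (i : Fin n) : Prop :=
  ∀ v < α i, ∃ j < i, α j = v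

/-- Restricted growth functions with values starting at `0`: the first occurrences of
`0, 1, 2, …` appear in this order, without gaps. -/
def IsRGF {n : ℕ} (α : Fin n → ℕ) : Prop :=
  ∀ i, IsRGFAt α i

section RestrictedGrowth

variable {n : ℕ} {α : Fin n → ℕ} {i i' : Fin n}

theorem isAscent_iff (hii' : (i' : ℕ) = i + 1) : IsAscent α i ↔ α i < α i' := by
  have hn : (i : ℕ) + 1 < n := hii' ▸ i'.2
  obtain rfl : i' = ⟨i + 1, hn⟩ := Fin.ext hii'
  exact ⟨fun h => h.2, fun h => ⟨_, h⟩⟩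

theorem ascPrefix_add_one (α : Fin n → ℕ) (m : ℕ) :
    ascPrefix α (m + 1) = Nat.count (IsAscent α) m := by
  rw [ascPrefix, Nat.count_eq_card_filter_range]
  congr 1
  ext j
  simp only [Finset.mem_filter, Finset.mem_range, Nat.add_lt_add_iff_right, and_iff_right_iff_imp,
    and_imp]
  exact fun _ h => Nat.lt_of_succ_lt h.1

theorem exists_eq_of_le_partialSups (hα : ∀ k ≤ i, IsRGFAt α k) {v : ℕ}
    (hv : v ≤ partialSups α i) : ∃ j ≤ i, α j = v := by
  obtain ⟨k, hk, hkv⟩ := exists_partialSups_eq α i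
  rw [hkv] at hv
  rcases hv.lt_or_eq with hlt | rfl
  · obtain ⟨j, hj, hjv⟩ := hα k hk v hlt
    exact ⟨j, hj.le.trans hk, hjv⟩
  · exact ⟨k, hk, rfl⟩

theorem partialSups_lt_of_lt (hα : ∀ k ≤ i, IsRGFAt α k)
    (h : ¬ ContainsPattern α ![0, 1, 0, 1]) (hii' : i < i') (hlt : α i < α i') :
    partialSups α i < α i' := by
  by_contra! hle
  obtain ⟨p, hp, hpv⟩ := exists_eq_of_le_partialSups hα hle
  have hpi : p < i := hp.lt_of_ne (by rintro rfl; exact hlt.ne hpv)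
  obtain ⟨o, ho, hov⟩ := hα p hp (α i) (hpv ▸ hlt)
  exact h ((containsPattern_0101_iff α).2
    ⟨o, p, i, i', ho, hpi, hii', hov, hpv, hpv ▸ hlt⟩)

theorem count_isAscent_le_partialSups (hα : ∀ k ≤ i, IsRGFAt α k)
    (h : ¬ ContainsPattern α ![0, 1, 0, 1]) : Nat.count (IsAscent α) i ≤ partialSups α i := by
  obtain ⟨m, hm⟩ := i
  induction m with
  | zero => simp
  | succ m ih =>
    have hlt : (⟨m, Nat.lt_of_succ_lt hm⟩ : Fin n) < ⟨m + 1, hm⟩ := Nat.lt_succ_self m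
    have hα' : ∀ k ≤ ⟨m, Nat.lt_of_succ_lt hm⟩, IsRGFAt α k := fun k hk => hα k (hk.trans hlt.le)
    have hcount := ih (Nat.lt_of_succ_lt hm) hα'
    rw [Nat.count_succ]
    split_ifs with hasc
    · calc Nat.count (IsAscent α) m + 1 ≤ partialSups α ⟨m, _⟩ + 1 := Nat.succ_le_succ hcount
        _ ≤ α ⟨m + 1, hm⟩ := partialSups_lt_of_lt hα' h hlt hasc.2
        _ ≤ partialSups α ⟨m + 1, hm⟩ := le_partialSups α _
    · exact hcount.trans ((partialSups α).monotone hlt.le)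

theorem IsAscentSeq.isRGF (hα : IsAscentSeq α) (h : ¬ ContainsPattern α ![0, 1, 0, 1]) :
    IsRGF α := by
  intro i
  induction i using WellFoundedLT.induction with
  | _ i ih =>
  intro v hv
  obtain ⟨m, hm⟩ := i
  cases m with
  | zero =>
    rw [(hα ⟨0, hm⟩).1 rfl] at hv
    exact absurd hv (Nat.not_lt_zero v)
  | succ m =>
    have hlt : (⟨m, Nat.lt_of_succ_lt hm⟩ : Fin n) < ⟨m + 1, hm⟩ := Nat.lt_succ_self m
    have hα' : ∀ k ≤ ⟨m, Nat.lt_of_succ_lt hm⟩, IsRGFAt α k := fun k hk => ih k (hk.trans_lt hlt)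
    have hle : α ⟨m + 1, hm⟩ ≤ 1 + ascPrefix α (m + 1) := (hα ⟨m + 1, hm⟩).2 (Nat.succ_ne_zero m)
    have hcount := count_isAscent_le_partialSups hα' h
    rw [ascPrefix_add_one] at hle
    simp only at hcount
    obtain ⟨j, hj, hjv⟩ := exists_eq_of_le_partialSups hα' (v := v) (by omega)
    exact ⟨j, hj.trans_lt hlt, hjv⟩

theorem IsRGF.containsPattern_0101_of_101 (hα : IsRGF α) (h : ContainsPattern α ![1, 0, 1]) :
    ContainsPattern α ![0, 1, 0, 1] := by
  obtain ⟨p, q, s, hpq, hqs, hps, hlt⟩ := (containsPattern_101_iff α).1 h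
  obtain ⟨o, hop, hoq⟩ := hα p (α q) hlt
  exact (containsPattern_0101_iff α).2 ⟨o, p, q, s, hop, hpq, hqs, hoq, hps, hlt⟩

theorem IsAscentSeq.containsPattern_0101_iff (hα : IsAscentSeq α) :
    ContainsPattern α ![0, 1, 0, 1] ↔ ContainsPattern α ![1, 0, 1] := by
  refine ⟨containsPattern_101_of_0101 α, fun h => ?_⟩
  by_contra h'
  exact h' ((hα.isRGF h').containsPattern_0101_of_101 h)

theorem IsRGF.modifyAt_eq_self (hα : IsRGF α) (h : ¬ ContainsPattern α ![0, 1, 0, 1]) {j : ℕ}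
    (hasc : IsAscent α j) : modifyAt α j = α := by
  obtain ⟨hj, hlt⟩ := hasc
  have hmax := partialSups_lt_of_lt (fun k _ => hα k) h
    (i := ⟨j, Nat.lt_of_succ_lt hj⟩) (i' := ⟨j + 1, hj⟩) (Nat.lt_succ_self j) hlt
  funext i
  rw [modifyAt, dif_pos hj, if_neg]
  rintro ⟨hi, hle⟩
  exact hle.not_gt ((le_partialSups_of_le α (Fin.le_def.2 hi.le)).trans_lt hmax)

theorem IsRGF.Delta_eq_self (hα : IsRGF α) (h : ¬ ContainsPattern α ![0, 1, 0, 1]) :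
    Delta α = α := by
  refine List.foldlRecOn (ascList α) modifyAt (motive := fun β => β = α) rfl ?_
  rintro _ rfl j hj
  exact hα.modifyAt_eq_self h (of_decide_eq_true (List.mem_filter.1 hj).2)

end RestrictedGrowth

/-! ### The transposition -/

/-- The columns `(α i, i)` of the flipped biword, in the order by which `transposition` sorts
them. -/
def columnKey {n : ℕ} (α : Fin n → ℕ) (i : Fin n) : ℕ ×ₗ (Fin n)ᵒᵈ :=
  toLex (α i, OrderDual.toDual i)

section Transposition

variable {n : ℕ} {α : Fin n → ℕ} {i i' : Fin n}

theorem columnKey_lt_columnKey_iff :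
    columnKey α i < columnKey α i' ↔ α i ≤ α i' ∧ (α i = α i' → i' < i) :=
  Prod.Lex.toLex_lt_toLex'

theorem columnKey_injective (α : Fin n → ℕ) : Function.Injective (columnKey α) :=
  fun _ _ h => congrArg (fun p : ℕ ×ₗ (Fin n)ᵒᵈ => OrderDual.ofDual (ofLex p).2) h

theorem strictMono_columnKey_comp_transposition (α : Fin n → ℕ) :
    StrictMono (columnKey α ∘ transposition α) :=
  (Tuple.monotone_sort (columnKey α)).strictMono_of_injective
    ((columnKey_injective α).comp (transposition α).injective)

theorem transposition_eq_of_strictMono {π : Equiv.Perm (Fin n)}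
    (h : StrictMono (columnKey α ∘ π)) : transposition α = π :=
  (Tuple.eq_sort_iff.2 ⟨h.monotone, fun _ _ hij heq => absurd heq (h hij).ne⟩).symm

theorem columnKey_lt_of_lt (h : i < i') :
    columnKey α (transposition α i) < columnKey α (transposition α i') :=
  strictMono_columnKey_comp_transposition α h

theorem transposition_symm_lt_symm_iff :
    (transposition α).symm i < (transposition α).symm i' ↔ columnKey α i < columnKey α i' := by
  simp [← (strictMono_columnKey_comp_transposition α).lt_iff_lt]

theorem monotone_comp_transposition (α : Fin n → ℕ) : Monotone (α ∘ transposition α) :=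
  fun _ _ h => Prod.Lex.monotone_fst _ _
    ((strictMono_columnKey_comp_transposition α).monotone h)

theorem transposition_le_of_le_of_eq (hle : i ≤ i')
    (heq : α (transposition α i) = α (transposition α i')) :
    transposition α i' ≤ transposition α i := by
  rcases hle.eq_or_lt with rfl | hlt
  · exact le_rfl
  · exact ((columnKey_lt_columnKey_iff.1 (columnKey_lt_of_lt hlt)).2 heq).le

theorem IsRGF.transposition_lt_of_lt (hα : IsRGF α) (hii' : (i' : ℕ) = i + 1)
    (hlt : α (transposition α i) < α (transposition α i')) {h : Fin n} (hih : i < h) :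
    transposition α i < transposition α h := by
  have hi'h : i' ≤ h := by rw [Fin.le_def, hii']; exact hih
  obtain ⟨j, hj, hjv⟩ := hα _ _ (hlt.trans_le (monotone_comp_transposition α hi'h))
  obtain ⟨k, rfl⟩ := (transposition α).surjective j
  have hki : k ≤ i := by
    by_contra! hik
    have hi'k : i' ≤ k := by rw [Fin.le_def, hii']; exact hik
    exact (hlt.trans_le (monotone_comp_transposition α hi'k)).ne' hjv
  exact (transposition_le_of_le_of_eq hki hjv).trans_lt hj

theorem IsRGF.transposition_lt_iff (hα : IsRGF α) (hii' : (i' : ℕ) = i + 1) :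
    transposition α i < transposition α i' ↔
      α (transposition α i) < α (transposition α i') := by
  have hlt : i < i' := by rw [Fin.lt_def, hii']; exact Nat.lt_succ_self i
  refine ⟨fun h => (monotone_comp_transposition α hlt.le).lt_of_ne fun heq => ?_,
    fun h => hα.transposition_lt_of_lt hii' h hlt⟩
  exact h.not_ge (transposition_le_of_le_of_eq hlt.le heq)

theorem IsRGF.apply_transposition_zero (hα : IsRGF α) (hi : (i : ℕ) = 0) :
    α (transposition α i) = 0 := by
  by_contra! hne
  obtain ⟨j, -, hj⟩ := hα _ 0 (Nat.pos_of_ne_zero hne)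
  obtain ⟨k, rfl⟩ := (transposition α).surjective j
  have hik : i ≤ k := by rw [Fin.le_def, hi]; exact Nat.zero_le k
  exact hne (Nat.le_zero.1 (hj ▸ monotone_comp_transposition α hik))

theorem IsRGF.apply_transposition_le_add_one (hα : IsRGF α) (hii' : (i' : ℕ) = i + 1) :
    α (transposition α i') ≤ α (transposition α i) + 1 := by
  by_contra! hlt
  obtain ⟨j, -, hj⟩ := hα _ _ hlt
  obtain ⟨k, rfl⟩ := (transposition α).surjective j
  rcases le_or_gt k i with hki | hik
  · have hle := monotone_comp_transposition α hki
    simp only [Function.comp_apply] at hle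
    omega
  · have hle := monotone_comp_transposition α (show i' ≤ k by rw [Fin.le_def, hii']; exact hik)
    simp only [Function.comp_apply] at hle
    omega

/-- The number of the maximal descending run of `π` that contains the value `x`, counted
from `0`. -/
def runIndex (π : Equiv.Perm (Fin n)) (x : Fin n) : ℕ :=
  Nat.count (IsAscent fun i => (π i : ℕ)) (π.symm x)

theorem IsRGF.runIndex_transposition (hα : IsRGF α) : runIndex (transposition α) = α := by
  suffices h : ∀ k (hk : k < n), Nat.count (IsAscent fun i => (transposition α i : ℕ)) k =
      α (transposition α ⟨k, hk⟩) by
    funext x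
    simp [runIndex, h]
  intro k hk
  induction k with
  | zero => simp [hα.apply_transposition_zero]
  | succ k ih =>
    have hk' := Nat.lt_of_succ_lt hk
    have hsucc : ((⟨k + 1, hk⟩ : Fin n) : ℕ) = (⟨k, hk'⟩ : Fin n) + 1 := rfl
    have hle := monotone_comp_transposition α (show (⟨k, hk'⟩ : Fin n) ≤ ⟨k + 1, hk⟩ from
      Nat.le_succ k)
    have hle' := hα.apply_transposition_le_add_one hsucc
    have hasc : IsAscent (fun i => (transposition α i : ℕ)) k ↔
        α (transposition α ⟨k, hk'⟩) < α (transposition α ⟨k + 1, hk⟩) :=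
      (isAscent_iff hsucc).trans (hα.transposition_lt_iff hsucc)
    simp only [Nat.count_succ, ih hk', hasc]
    simp only [Function.comp_apply] at hle
    split_ifs <;> omega

theorem transposition_runIndex (π : Equiv.Perm (Fin n)) : transposition (runIndex π) = π := by
  refine transposition_eq_of_strictMono ?_
  cases n with
  | zero => exact Subsingleton.strictMono _
  | succ n =>
    refine Fin.strictMono_iff_lt_succ.2 fun i => columnKey_lt_columnKey_iff.2 ?_
    have hasc : IsAscent (fun i => (π i : ℕ)) i ↔ π i.castSucc < π i.succ :=
      isAscent_iff (i := i.castSucc) rfl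
    have hne : π i.succ ≠ π i.castSucc := π.injective.ne i.castSucc_lt_succ.ne'
    simp only [runIndex, Equiv.symm_apply_apply, Fin.val_castSucc, Fin.val_succ, Nat.count_succ,
      hasc]
    exact ⟨Nat.le_add_right _ _, fun heq =>
      (not_lt.1 fun hlt => by simp [hlt] at heq).lt_of_ne hne⟩

/-- Every ascent bottom of `π` is smaller than all the later entries. Among the permutations that
avoid `3142`, these are the Fishburn permutations. -/
def HasMinimalAscentBottoms (π : Equiv.Perm (Fin n)) : Prop :=
  ∀ i i' : Fin n, (i' : ℕ) = i + 1 → π i < π i' → ∀ h, i < h → π i < π h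

theorem HasMinimalAscentBottoms.isFishburn {π : Equiv.Perm (Fin n)}
    (hπ : HasMinimalAscentBottoms π) : IsFishburn π := by
  rintro ⟨i, i', j, hii', hij, hval, hasc⟩
  have hlt := hπ i i' hii' hasc j (by omega)
  omega

theorem exists_val_eq_add_one_of_lt {π : Equiv.Perm (Fin n)} {i h : Fin n} (hih : i < h)
    (hlt : π h < π i) : ∃ k ≤ i, ∃ j, i < j ∧ (π k : ℕ) = π j + 1 ∧ π j < π i := by
  obtain ⟨c, -, hc, ⟨j, hij, rfl⟩, hsucc⟩ :=
    exists_and_not_succ (p := fun v => ∃ j, i < j ∧ (π j : ℕ) = v) (Fin.le_def.1 hlt.le)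
      ⟨h, hih, rfl⟩ (by
        rintro ⟨j, hij, hj⟩
        exact hij.ne' (π.injective (Fin.ext hj)))
  have hn : (π j : ℕ) + 1 < n := by omega
  refine ⟨π.symm ⟨π j + 1, hn⟩, ?_, j, hij, by simp, hc⟩
  by_contra! hik
  exact hsucc ⟨_, hik, by simp⟩

theorem IsFishburn.hasMinimalAscentBottoms {π : Equiv.Perm (Fin n)} (hπ : IsFishburn π)
    (h : ¬ ContainsPattern π ![3, 1, 4, 2]) : HasMinimalAscentBottoms π := by
  intro i i' hii' hasc m him
  by_contra! hle
  obtain ⟨k, hki, j, hij, hkj, hji⟩ :=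
    exists_val_eq_add_one_of_lt him (hle.lt_of_ne (π.injective.ne him.ne'))
  have hi'j : i' < j := by
    have hne : i' ≠ j := by rintro rfl; exact lt_asymm hji hasc
    omega
  rcases hki.eq_or_lt with rfl | hki
  · exact hπ ⟨k, i', j, hii', hi'j, hkj.symm, hasc⟩
  obtain ⟨k', hkk'⟩ : ∃ k' : Fin n, (k' : ℕ) = k + 1 := ⟨⟨k + 1, by omega⟩, rfl⟩
  have hk'j : π k' < π j := by
    have hdesc : ¬ π k < π k' := fun hlt =>
      hπ ⟨k, k', j, hkk', by omega, hkj.symm, hlt⟩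
    have hne : π k' ≠ π j := π.injective.ne (by omega)
    have hne' : π k' ≠ π k := π.injective.ne (by omega)
    omega
  have hk'i : k' ≠ i := by rintro rfl; exact lt_asymm hk'j hji
  have hki' : π k ≠ π i := π.injective.ne hki.ne
  exact h ((containsPattern_3142_iff π).2
    ⟨k, k', i, j, by omega, by omega, hij, hk'j, by omega, by omega⟩)

theorem IsRGF.hasMinimalAscentBottoms (hα : IsRGF α) :
    HasMinimalAscentBottoms (transposition α) := fun _ _ hii' hasc _ hih =>
  hα.transposition_lt_of_lt hii' ((hα.transposition_lt_iff hii').1 hasc) hih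

theorem HasMinimalAscentBottoms.isRGF_runIndex {π : Equiv.Perm (Fin n)}
    (hπ : HasMinimalAscentBottoms π) : IsRGF (runIndex π) := by
  intro x v hv
  obtain ⟨k, hkx, ⟨hk, hasc⟩, hkv⟩ := exists_count_eq_of_lt_count hv
  refine ⟨π ⟨k, Nat.lt_of_succ_lt hk⟩, ?_, by simpa [runIndex] using hkv⟩
  simpa using hπ _ _ rfl hasc (π.symm x) hkx

theorem IsRGF.containsPattern_3142_transposition_iff (hα : IsRGF α) :
    ContainsPattern (transposition α) ![3, 1, 4, 2] ↔ ContainsPattern α ![1, 0, 1] := by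
  rw [containsPattern_3142_iff, containsPattern_101_iff]
  constructor
  · rintro ⟨a, b, c, d, hab, hbc, hcd, -, hda, hac⟩
    have hlt : α (transposition α a) < α (transposition α c) :=
      (monotone_comp_transposition α (hab.trans hbc).le).lt_of_ne fun heq =>
        hac.not_ge (transposition_le_of_le_of_eq (hab.trans hbc).le heq)
    obtain ⟨p, hp, hpc⟩ : ∃ p < transposition α a, α p = α (transposition α c) := by
      rcases (monotone_comp_transposition α hcd.le).lt_or_eq with hlt' | heq
      · obtain ⟨p, hp, hpc⟩ := hα _ _ hlt'
        exact ⟨p, hp.trans hda, hpc⟩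
      · exact ⟨_, hda, heq.symm⟩
    exact ⟨p, _, _, hp, hac, hpc, hpc ▸ hlt⟩
  · rintro ⟨p, q, s, hpq, hqs, hps, hlt⟩
    obtain ⟨o, hop, hoq⟩ := hα p _ hlt
    have hkey : ∀ {x y}, α x ≤ α y ∧ (α x = α y → y < x) →
        (transposition α).symm x < (transposition α).symm y := fun h =>
      transposition_symm_lt_symm_iff.2 (columnKey_lt_columnKey_iff.2 h)
    refine ⟨_, _, _, _, hkey (x := q) (y := o) ⟨hoq.ge, fun _ => hop.trans hpq⟩,
      hkey (y := s) ⟨by omega, fun h => by omega⟩, hkey (y := p) ⟨hps.ge, fun _ => hpq.trans hqs⟩,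
      ?_⟩
    simpa using ⟨hop, hpq, hqs⟩

theorem transposition_bijOn (n : ℕ) :
    Set.BijOn (transposition (n := n)) {α | IsRGF α ∧ ¬ ContainsPattern α ![1, 0, 1]}
      {π | IsFishburn π ∧ ¬ ContainsPattern π ![3, 1, 4, 2]} := by
  refine ⟨?_, ?_, ?_⟩
  · rintro α ⟨hα, h⟩
    exact ⟨hα.hasMinimalAscentBottoms.isFishburn,
      mt hα.containsPattern_3142_transposition_iff.1 h⟩
  · rintro α ⟨hα, -⟩ β ⟨hβ, -⟩ heq
    rw [← hα.runIndex_transposition, heq, hβ.runIndex_transposition]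
  · rintro π ⟨hπ, h⟩
    have hrgf := (hπ.hasMinimalAscentBottoms h).isRGF_runIndex
    refine ⟨runIndex π, ⟨hrgf, fun h101 => h ?_⟩, transposition_runIndex π⟩
    rw [← transposition_runIndex π]
    exact hrgf.containsPattern_3142_transposition_iff.2 h101

end Transposition

/-! ### Families of intervals -/

theorem eq_of_monotone_of_comp_perm_eq {α : Type*} [PartialOrder α] {n : ℕ} {f g : Fin n → α}
    (hf : Monotone f) (hg : Monotone g) {σ τ : Equiv.Perm (Fin n)} (h : f ∘ σ = g ∘ τ) :
    f = g := by
  have hgf : f ∘ (τ.symm.trans σ) = g := by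
    rw [Equiv.coe_trans, ← Function.comp_assoc, h, Function.comp_assoc, Equiv.self_comp_symm,
      Function.comp_id]
  rw [← hgf] at hg ⊢
  exact Tuple.unique_monotone (σ := Equiv.refl _) hf hg

theorem monotone_snoc {α : Type*} [Preorder α] {n : ℕ} {f : Fin n → α} {a : α} (hf : Monotone f)
    (ha : ∀ i, f i ≤ a) : Monotone (Fin.snoc f a : Fin (n + 1) → α) := by
  intro i j hij
  induction j using Fin.lastCases with
  | last =>
    induction i using Fin.lastCases with
    | last => exact le_rfl
    | cast i => simpa using ha i
  | cast j =>
    induction i using Fin.lastCases with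
    | last => exact absurd hij j.castSucc_lt_last.not_ge
    | cast i => simpa using hf (Fin.castSucc_le_castSucc_iff.1 hij)

/-- The intervals `[ℓ x, r x]`, `x ∈ s`, of natural numbers are pointed: every point `j` up to the
largest endpoint occurs among them as the interval `[j, j]`. -/
structure IsPointed {V : Type*} (s : Finset V) (ℓ r : V → ℕ) : Prop where
  le : ∀ x ∈ s, ℓ x ≤ r x
  exists_point : ∀ x ∈ s, ∀ j ≤ r x, ∃ z ∈ s, ℓ z = j ∧ r z = j

/-- Any two of the intervals `[ℓ x, r x]` are nested or disjoint. -/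
def IsNoncrossing {V : Type*} (ℓ r : V → ℕ) : Prop :=
  ∀ x y, ℓ x < ℓ y → ℓ y ≤ r x → r y ≤ r x

/-- The key that sorts the intervals `[ℓ x, r x]` lexicographically. -/
def leftKey {V : Type*} (ℓ r : V → ℕ) (x : V) : ℕ ×ₗ ℕ :=
  toLex (ℓ x, r x)

/-- The key that sorts the intervals `[ℓ x, r x]` by increasing right endpoints, and intervals with
the same right endpoint by decreasing left endpoints. -/
def rightKey {V : Type*} (ℓ r : V → ℕ) (x : V) : ℕ ×ₗ ℕᵒᵈ :=
  toLex (r x, OrderDual.toDual (ℓ x))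

section Keys

variable {V : Type*} {ℓ r : V → ℕ} {x y : V}

theorem leftKey_le_leftKey_iff :
    leftKey ℓ r x ≤ leftKey ℓ r y ↔ ℓ x ≤ ℓ y ∧ (ℓ x = ℓ y → r x ≤ r y) :=
  Prod.Lex.toLex_le_toLex'

theorem leftKey_lt_leftKey_iff :
    leftKey ℓ r x < leftKey ℓ r y ↔ ℓ x ≤ ℓ y ∧ (ℓ x = ℓ y → r x < r y) :=
  Prod.Lex.toLex_lt_toLex'

theorem rightKey_le_rightKey_iff :
    rightKey ℓ r x ≤ rightKey ℓ r y ↔ r x ≤ r y ∧ (r x = r y → ℓ y ≤ ℓ x) :=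
  Prod.Lex.toLex_le_toLex'

end Keys

theorem IsPointed.strictMonoOn_filter_lt {V : Type*} {s : Finset V} {ℓ r : V → ℕ}
    (h : IsPointed s ℓ r) {x : V} (hx : x ∈ s) :
    StrictMonoOn (fun j => s.filter (r · < j)) (Set.Iic (r x)) := by
  intro i hi j _ hij
  refine Finset.ssubset_iff_subset_ne.2
    ⟨Finset.monotone_filter_right _ fun _ _ hlt => hlt.trans hij, fun heq => ?_⟩
  obtain ⟨z, hz, -, hzi⟩ := h.exists_point x hx i hi
  have hmem : z ∈ s.filter (r · < i) := by
    rw [show s.filter (r · < i) = s.filter (r · < j) from heq]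
    exact Finset.mem_filter.2 ⟨hz, hzi.trans_lt hij⟩
  exact (Finset.mem_filter.1 hmem).2.ne hzi

theorem IsPointed.erase {V : Type*} [DecidableEq V] {s : Finset V} {ℓ r : V → ℕ}
    (h : IsPointed s ℓ r) {y : V} (hy : ∀ z ∈ s, rightKey ℓ r z ≤ rightKey ℓ r y) :
    IsPointed (s.erase y) ℓ r where
  le x hx := h.le x (Finset.mem_of_mem_erase hx)
  exists_point x hx j hj := by
    have hxs := Finset.mem_of_mem_erase hx
    obtain ⟨z, hz, hzl, hzr⟩ := h.exists_point x hxs j hj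
    rcases eq_or_ne z y with rfl | hne
    · obtain ⟨hr, hl⟩ := rightKey_le_rightKey_iff.1 (hy x hxs)
      have hxr : r x = r z := hr.antisymm (hzr ▸ hj)
      exact ⟨x, hx, le_antisymm ((h.le x hxs).trans (hxr.trans hzr).le) (hzl ▸ hl hxr),
        hxr.trans hzr⟩
    · exact ⟨z, Finset.mem_erase.2 ⟨hne, hz⟩, hzl, hzr⟩

theorem IsNoncrossing.comp {V W : Type*} {ℓ r : V → ℕ} (h : IsNoncrossing ℓ r) (f : W → V) :
    IsNoncrossing (ℓ ∘ f) (r ∘ f) :=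
  fun x y => h (f x) (f y)

theorem IsNoncrossing.exists_point {V : Type*} {ℓ r : V → ℕ} (h : IsNoncrossing ℓ r)
    (hle : ∀ x, ℓ x ≤ r x) {x y : V} (hxy : ℓ x = r y) : ∃ z, ℓ z = ℓ x ∧ r z = ℓ x := by
  rcases (hle y).eq_or_lt with hy | hy
  · exact ⟨y, hy.trans hxy.symm, hxy.symm⟩
  · have hxr : r x ≤ ℓ x := hxy ▸ h y x (hxy ▸ hy) hxy.le
    exact ⟨x, rfl, hxr.antisymm (hle x)⟩

section RightSorted

variable {n : ℕ} {ℓ r : Fin n → ℕ}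

theorem IsPointed.comp_perm (h : IsPointed Finset.univ ℓ r) (σ : Equiv.Perm (Fin n)) :
    IsPointed Finset.univ (ℓ ∘ σ) (r ∘ σ) where
  le i _ := h.le (σ i) (Finset.mem_univ _)
  exists_point i _ j hj := by
    obtain ⟨k, -, hk⟩ := h.exists_point (σ i) (Finset.mem_univ _) j hj
    exact ⟨σ.symm k, Finset.mem_univ _, by simpa using hk⟩

theorem monotone_of_monotone_rightKey (hsort : Monotone (rightKey ℓ r)) : Monotone r :=
  fun _ _ hij => (rightKey_le_rightKey_iff.1 (hsort hij)).1

theorem IsPointed.isRGF (h : IsPointed Finset.univ ℓ r) (hr : Monotone r) : IsRGF ℓ := by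
  intro i v hv
  have hle : ℓ i ≤ r i := h.le i (Finset.mem_univ i)
  obtain ⟨k, -, hkv, hkr⟩ := h.exists_point i (Finset.mem_univ i) v (hv.le.trans hle)
  exact ⟨k, hr.reflect_lt (hkr ▸ hv.trans_le hle), hkv⟩

theorem IsPointed.partialSups_eq (h : IsPointed Finset.univ ℓ r)
    (hsort : Monotone (rightKey ℓ r)) : partialSups ℓ = r := by
  have hr := monotone_of_monotone_rightKey hsort
  funext i
  refine le_antisymm (partialSups_le ℓ i (r i) fun j hj =>
    (h.le j (Finset.mem_univ j)).trans (hr hj)) ?_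
  obtain ⟨k, -, hkl, hkr⟩ := h.exists_point i (Finset.mem_univ i) (r i) le_rfl
  rcases le_or_gt k i with hki | hik
  · exact hkl ▸ le_partialSups_of_le ℓ hki
  · have hki : ℓ k ≤ ℓ i := (rightKey_le_rightKey_iff.1 (hsort hik.le)).2 hkr.symm
    exact (hkl ▸ hki).trans (le_partialSups ℓ i)

theorem IsNoncrossing.not_containsPattern_101 (h : IsNoncrossing ℓ r) (hle : ∀ i, ℓ i ≤ r i)
    (hsort : Monotone (rightKey ℓ r)) : ¬ ContainsPattern ℓ ![1, 0, 1] := by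
  rw [containsPattern_101_iff]
  rintro ⟨p, q, s, hpq, hqs, hps, hlt⟩
  have hr := monotone_of_monotone_rightKey hsort
  have hsq : r s ≤ r q := h q s (hps ▸ hlt) ((hps ▸ hle p).trans (hr hpq.le))
  have hle : ℓ s ≤ ℓ q :=
    (rightKey_le_rightKey_iff.1 (hsort hqs.le)).2 ((hr hqs.le).antisymm hsq)
  exact (hps ▸ hlt).not_ge hle

theorem IsPointed.eq_of_comp_eq {ℓ' r' : Fin n → ℕ} {σ σ' : Equiv.Perm (Fin n)}
    (h : IsPointed Finset.univ ℓ r) (hlex : Monotone (leftKey ℓ r))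
    (hσ : Monotone (rightKey ℓ r ∘ σ)) (h' : IsPointed Finset.univ ℓ' r')
    (hlex' : Monotone (leftKey ℓ' r')) (hσ' : Monotone (rightKey ℓ' r' ∘ σ'))
    (heq : ℓ ∘ σ = ℓ' ∘ σ') : ℓ = ℓ' ∧ r = r' := by
  have hr : r ∘ σ = r' ∘ σ' := by
    rw [← (h.comp_perm σ).partialSups_eq hσ, ← (h'.comp_perm σ').partialSups_eq hσ', heq]
  have hkey : leftKey ℓ r = leftKey ℓ' r' :=
    eq_of_monotone_of_comp_perm_eq hlex hlex'
      (funext fun i => congrArg₂ (fun a b => toLex (a, b)) (congrFun heq i) (congrFun hr i))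
  exact ⟨funext fun i => congrArg (fun p => (ofLex p).1) (congrFun hkey i),
    funext fun i => congrArg (fun p => (ofLex p).2) (congrFun hkey i)⟩

end RightSorted

section PartialSups

variable {n : ℕ} {α : Fin n → ℕ} {i j : Fin n}

theorem IsRGF.le_of_le_partialSups (hα : IsRGF α) (h : ¬ ContainsPattern α ![1, 0, 1])
    (hij : i ≤ j) (hle : α j ≤ partialSups α i) : α j ≤ α i := by
  by_contra! hlt
  obtain ⟨k, hk, hkj⟩ := exists_eq_of_le_partialSups (fun k _ => hα k) hle
  have hki : k ≠ i := by rintro rfl; exact hlt.ne hkj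
  have hij' : i ≠ j := by rintro rfl; exact lt_irrefl _ hlt
  exact h ((containsPattern_101_iff α).2
    ⟨k, i, j, hk.lt_of_ne hki, hij.lt_of_ne hij', hkj, hkj ▸ hlt⟩)

theorem IsRGF.monotone_rightKey (hα : IsRGF α) (h : ¬ ContainsPattern α ![1, 0, 1]) :
    Monotone (rightKey α (partialSups α)) := fun _ j hij =>
  rightKey_le_rightKey_iff.2 ⟨(partialSups α).monotone hij, fun heq =>
    hα.le_of_le_partialSups h hij (heq ▸ le_partialSups α j)⟩

theorem IsRGF.isNoncrossing (hα : IsRGF α) (h : ¬ ContainsPattern α ![1, 0, 1]) :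
    IsNoncrossing α (partialSups α) := by
  intro i j hlt hle
  by_contra! hsup
  have hij : i < j := (partialSups α).monotone.reflect_lt hsup
  exact hlt.not_ge (hα.le_of_le_partialSups h hij.le hle)

theorem IsRGF.isPointed (hα : IsRGF α) : IsPointed Finset.univ α (partialSups α) where
  le i _ := le_partialSups α i
  exists_point i _ v hv := by
    obtain ⟨j, -, hj⟩ := exists_eq_of_le_partialSups (fun k _ => hα k) hv
    obtain ⟨k, hkv, hk⟩ := exists_minimal_of_wellFoundedLT (fun k => α k = v) ⟨j, hj⟩
    refine ⟨k, Finset.mem_univ k, hkv, le_antisymm ?_ (hkv ▸ le_partialSups α k)⟩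
    by_contra! hlt
    obtain ⟨m, hmk, hm⟩ := exists_partialSups_eq α k
    obtain ⟨o, hom, ho⟩ := hα m v (hm ▸ hlt)
    exact (hk ho (hom.le.trans hmk)).not_gt (hom.trans_le hmk)

end PartialSups

/-! ### Interval orders of pointed families -/

namespace FinPoset

variable {V : Type}

section Remove

variable [LinearOrder V]

theorem exists_remove_eq_removeAt (P : FinPoset V) (h : P.maximals.Nonempty) :
    ∃ y ∈ P.maximals, P.level y = P.minMaxLevel ∧ (∀ z ∈ P.maximals, P.level y ≤ P.level z) ∧
      P.remove = P.removeAt y := by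
  have hmin : ((P.minMaxLevel : ℕ) : WithTop ℕ) = (P.maximals.image P.level).min := by
    obtain ⟨a, ha⟩ := Finset.min_of_nonempty (h.image P.level)
    rw [minMaxLevel, ha]
    rfl
  obtain ⟨x, hx, hxl⟩ := Finset.mem_image.1 (Finset.mem_of_min hmin.symm)
  obtain ⟨y, hy⟩ := Finset.min_of_nonempty
    (⟨x, Finset.mem_filter.2 ⟨hx, hxl⟩⟩ :
      (P.maximals.filter fun x => P.level x = P.minMaxLevel).Nonempty)
  obtain ⟨hymax, hyl⟩ := Finset.mem_filter.1 (Finset.mem_of_min hy)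
  refine ⟨y, hymax, hyl, fun z hz => ?_, by rw [remove, hy]⟩
  have hle := Finset.min_le (Finset.mem_image_of_mem P.level hz)
  rw [← hmin, ← hyl] at hle
  exact WithTop.coe_le_coe.1 hle

theorem toSeq_succ {n : ℕ} (P : FinPoset V) (hn : P.carrier.card = n + 1)
    (hn' : P.remove.carrier.card = n) :
    P.toSeq (n + 1) hn = Fin.snoc (P.remove.toSeq n hn') P.minMaxLevel := by
  funext i
  induction i using Fin.lastCases with
  | last => simp [toSeq]
  | cast i =>
    rw [Fin.snoc_castSucc, toSeq, toSeq, ← Function.iterate_succ_apply, Fin.val_castSucc,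
      show n + 1 - 1 - (i : ℕ) = (n - 1 - i) + 1 by omega]

end Remove

/-- `P` is the interval order of the pointed family of intervals `[ℓ x, r x]`, `x ∈ P`. -/
structure IsPointedIntervalOrder (P : FinPoset V) (ℓ r : V → ℕ) : Prop
    extends Fishburn.IsPointed P.carrier ℓ r where
  lt_iff : ∀ x y, P.lt x y ↔ x ∈ P.carrier ∧ y ∈ P.carrier ∧ r x < ℓ y

namespace IsPointedIntervalOrder

variable {P : FinPoset V} {ℓ r : V → ℕ} {x y : V}

theorem down_eq (h : P.IsPointedIntervalOrder ℓ r) (hx : x ∈ P.carrier) :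
    P.down x = P.carrier.filter (r · < ℓ x) :=
  Finset.filter_congr fun z hz => by simp only [h.lt_iff, hz, hx, true_and]

theorem mem_maximals (h : P.IsPointedIntervalOrder ℓ r) :
    x ∈ P.maximals ↔ x ∈ P.carrier ∧ ∀ z ∈ P.carrier, r z ≤ r x := by
  refine Finset.mem_filter.trans (and_congr_right fun hx => ?_)
  simp only [h.lt_iff, hx, true_and, not_and, not_lt]
  constructor
  · intro hmax z hz
    obtain ⟨w, hw, hwl, -⟩ := h.exists_point z hz (r z) le_rfl
    exact hwl ▸ hmax w hw hw
  · exact fun hmax z hz _ => (h.le z hz).trans (hmax z hz)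

variable [LinearOrder V]

theorem level_eq (h : P.IsPointedIntervalOrder ℓ r) (hx : x ∈ P.carrier) :
    P.level x = ℓ x := by
  have hmono := h.toIsPointed.strictMonoOn_filter_lt hx
  have himage : (P.carrier.image P.down).filter (· ⊂ P.down x) =
      (Finset.range (ℓ x)).image fun j => P.carrier.filter (r · < j) := by
    ext d
    simp only [Finset.mem_filter, Finset.mem_image, Finset.mem_range]
    constructor
    · rintro ⟨⟨z, hz, rfl⟩, hlt⟩
      rw [h.down_eq hz, h.down_eq hx] at hlt
      refine ⟨ℓ z, ?_, (h.down_eq hz).symm⟩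
      by_contra! hle
      exact hlt.not_ge (Finset.monotone_filter_right _ fun _ _ hw => hw.trans_le hle)
    · rintro ⟨j, hj, rfl⟩
      have hjr : j ≤ r x := hj.le.trans (h.le x hx)
      obtain ⟨z, hz, rfl, -⟩ := h.exists_point x hx j hjr
      refine ⟨⟨z, hz, h.down_eq hz⟩, ?_⟩
      rw [h.down_eq hx]
      exact hmono hjr (h.le x hx) hj
  rw [level, himage, Finset.card_image_of_injOn, Finset.card_range]
  exact hmono.injOn.mono fun j hj => (Finset.mem_range.1 hj).le.trans (h.le x hx)

theorem freed_eq_empty (h : P.IsPointedIntervalOrder ℓ r) (hy : y ∈ P.carrier)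
    (hmax : ∀ z ∈ P.carrier, r z ≤ r y) : P.freed y = ∅ := by
  have hmem (z : V) (i : ℕ) : z ∈ P.levelSet i ↔ z ∈ P.carrier ∧ ℓ z = i :=
    Finset.mem_filter.trans (and_congr_right fun hz => by rw [h.level_eq hz])
  rw [freed, h.level_eq hy]
  split_ifs with hsing
  · obtain ⟨z, hz, hzl, hzr⟩ := h.exists_point y hy (ℓ y) (h.le y hy)
    obtain rfl : z = y := Finset.mem_singleton.1 (hsing ▸ (hmem z (ℓ y)).2 ⟨hz, hzl⟩)
    rw [show P.levelSet (ℓ z + 1) = ∅ from ?_, Finset.biUnion_empty]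
    refine Finset.eq_empty_of_forall_notMem fun w hw => ?_
    obtain ⟨hwP, hwl⟩ := (hmem w _).1 hw
    have hle := (h.le w hwP).trans (hmax w hwP)
    omega
  · rfl

theorem removeAt (h : P.IsPointedIntervalOrder ℓ r) (hy : y ∈ P.carrier)
    (hmax : ∀ z ∈ P.carrier, rightKey ℓ r z ≤ rightKey ℓ r y) :
    (P.removeAt y).IsPointedIntervalOrder ℓ r where
  toIsPointed := h.toIsPointed.erase hmax
  lt_iff u v := by
    have hfreed := h.freed_eq_empty hy fun z hz => (rightKey_le_rightKey_iff.1 (hmax z hz)).1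
    simp only [FinPoset.removeAt, hfreed, h.lt_iff, Finset.mem_erase, Finset.notMem_empty]
    tauto

theorem exists_remove_eq (h : P.IsPointedIntervalOrder ℓ r) (hne : P.carrier.Nonempty) :
    ∃ y ∈ P.carrier, (∀ z ∈ P.carrier, rightKey ℓ r z ≤ rightKey ℓ r y) ∧
      P.minMaxLevel = ℓ y ∧ P.remove = P.removeAt y := by
  obtain ⟨t, ht, htmax⟩ := P.carrier.exists_max_image r hne
  obtain ⟨y, hymax, hyl, hmin, hrem⟩ :=
    P.exists_remove_eq_removeAt ⟨t, h.mem_maximals.2 ⟨ht, htmax⟩⟩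
  obtain ⟨hy, hyr⟩ := h.mem_maximals.1 hymax
  rw [h.level_eq hy] at hyl hmin
  refine ⟨y, hy, fun z hz => rightKey_le_rightKey_iff.2 ⟨hyr z hz, fun hzr => ?_⟩,
    hyl.symm, hrem⟩
  rw [← h.level_eq hz]
  exact hmin z (h.mem_maximals.2 ⟨hz, hzr ▸ hyr⟩)

theorem exists_toSeq_eq {n : ℕ} (h : P.IsPointedIntervalOrder ℓ r) (hn : P.carrier.card = n) :
    ∃ σ : Fin n → V, Function.Injective σ ∧ (∀ i, σ i ∈ P.carrier) ∧
      Monotone (rightKey ℓ r ∘ σ) ∧ P.toSeq n hn = ℓ ∘ σ := by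
  induction n generalizing P with
  | zero =>
    exact ⟨Fin.elim0, fun i => i.elim0, fun i => i.elim0, fun i => i.elim0,
      funext fun i => i.elim0⟩
  | succ n ih =>
    obtain ⟨y, hy, hmax, hlev, hrem⟩ := h.exists_remove_eq (Finset.card_pos.1 (by omega))
    have hn' : P.remove.carrier.card = n := by
      rw [hrem, FinPoset.removeAt, Finset.card_erase_of_mem hy, hn, Nat.add_sub_cancel]
    obtain ⟨σ, hinj, hmem, hsort, hseq⟩ := ih (hrem ▸ h.removeAt hy hmax) hn'
    have hσ (i) : σ i ≠ y ∧ σ i ∈ P.carrier := by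
      simpa [hrem, FinPoset.removeAt] using hmem i
    refine ⟨Fin.snoc σ y, Fin.snoc_injective_iff.2 ⟨hinj, fun ⟨i, hi⟩ => (hσ i).1 hi⟩,
      fun i => ?_, ?_, ?_⟩
    · induction i using Fin.lastCases with
      | last => simpa using hy
      | cast i => simpa using (hσ i).2
    · rw [Fin.comp_snoc]
      exact monotone_snoc hsort fun i => hmax _ (hσ i).2
    · rw [P.toSeq_succ hn hn', Fin.comp_snoc, hseq, hlev]

end IsPointedIntervalOrder

end FinPoset

/-! ### Matchings and intervals -/

theorem eq_of_bijective_of_lt_imp_lt {ι : Type*} {m : ℕ} {f g : ι → Fin m}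
    (hf : Function.Bijective f) (hg : Function.Bijective g) (h : ∀ s t, f s < f t → g s < g t) :
    f = g := by
  let e := Equiv.ofBijective f hf
  let e' := Equiv.ofBijective g hg
  have hmono : StrictMono (e.symm.trans e') := fun p q hpq =>
    h _ _ (by simpa [e, Equiv.ofBijective_apply_symm_apply] using hpq)
  have hid : e.symm.trans e' = 1 := (Equiv.Perm.monotone_iff _).1 hmono.monotone
  funext s
  simpa [e, e'] using (Equiv.congr_fun hid (e s)).symm

theorem le_of_forall_adjacent {ι β : Type*} [Preorder β] {f : ι → ℕ} {g : ι → β}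
    (hf : Function.Injective f) (hadj : ∀ k w, f w = f k + 1 → g k ≤ g w) {i j : ι}
    (hij : f i ≤ f j) (hrange : ∀ q, f i ≤ q → q ≤ f j → ∃ k, f k = q) : g i ≤ g j := by
  suffices ∀ q, f i ≤ q → q ≤ f j → ∀ k, f k = q → g i ≤ g k from this _ hij le_rfl j rfl
  intro q hq
  induction q, hq using Nat.le_induction with
  | base =>
    intro _ k hk
    rw [hf hk]
  | succ q hq ih =>
    intro hqj k hk
    obtain ⟨w, hw⟩ := hrange q hq (by omega)
    exact (ih (by omega) w hw).trans (hadj w k (by omega))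

namespace Matching

variable {n : ℕ}

theorem opener_ne_closer (M : Matching n) (i j : Fin n) : M.opener i ≠ M.closer j := fun h =>
  Sum.inl_ne_inr (M.endpoints_bijective.1 (a₁ := .inl i) (a₂ := .inr j) h)

theorem closer_injective (M : Matching n) : Function.Injective M.closer := fun i j h =>
  Sum.inr_injective (M.endpoints_bijective.1 (a₁ := .inr i) (a₂ := .inr j) h)

theorem exists_opener_or_closer_eq (M : Matching n) {p : ℕ} (hp : p < 2 * n) :
    (∃ i, (M.opener i : ℕ) = p) ∨ ∃ i, (M.closer i : ℕ) = p := by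
  obtain ⟨i | i, h⟩ := M.endpoints_bijective.2 ⟨p, hp⟩
  · exact .inl ⟨i, congrArg Fin.val h⟩
  · exact .inr ⟨i, congrArg Fin.val h⟩

theorem eq_of_endpoints_eq {M M' : Matching n}
    (h : Sum.elim M.opener M.closer = Sum.elim M'.opener M'.closer) : M = M' := by
  obtain ⟨o, c, _, _, _⟩ := M
  obtain ⟨o', c', _, _, _⟩ := M'
  obtain rfl : o = o' := funext fun i => congrFun h (.inl i)
  obtain rfl : c = c' := funext fun i => congrFun h (.inr i)
  rfl

theorem contains_patternP2_iff (M : Matching n) :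
    M.Contains patternP2 ↔ ∃ a b c d, M.opener a < M.opener b ∧ M.opener b < M.closer a ∧
      M.closer a < M.opener c ∧ M.opener c < M.closer b ∧ M.closer b < M.opener d ∧
      M.opener d < M.closer c ∧ M.closer c < M.closer d := by
  constructor
  · rintro ⟨f, hf⟩
    have hac := (hf 2 0).2
    have hbd := (hf 3 1).2
    refine ⟨f 0, f 1, f 2, f 3, M.opener_strictMono (f.strictMono (by decide)),
      (hf 1 0).2.1 (by decide), ?_, (hf 2 1).2.1 (by decide), ?_, (hf 3 2).2.1 (by decide),
      (hf 2 3).1.1 (by decide)⟩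
    · exact (not_lt.1 (hac.not.1 (by decide))).lt_of_ne (M.opener_ne_closer _ _).symm
    · exact (not_lt.1 (hbd.not.1 (by decide))).lt_of_ne (M.opener_ne_closer _ _).symm
  · rintro ⟨a, b, c, d, hab, hba, hac, hcb, hbd, hdc, hcd⟩
    have hab' : a < b := M.opener_strictMono.lt_iff_lt.1 hab
    have hbc : b < c := M.opener_strictMono.lt_iff_lt.1 (hba.trans hac)
    have hcd' : c < d := M.opener_strictMono.lt_iff_lt.1 (hcb.trans hbd)
    refine ⟨OrderEmbedding.ofStrictMono ![a, b, c, d] (Fin.strictMono_iff_lt_succ.2 fun i => ?_),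
      fun s t => ?_⟩
    · fin_cases i <;> simp [hab', hbc, hcd']
    · fin_cases s <;> fin_cases t <;> simp [patternP2] <;> omega

/-- The order of the endpoints of `M` is the one given by the intervals `[ℓ i, r i]`: the points are
sorted by the numbers `ℓ i` (for openers) and `r i` (for closers), where at the same number the
openers come before the closers, and earlier arcs come first. -/
structure Represents (M : Matching n) (ℓ r : Fin n → ℕ) : Prop where
  closer_lt_opener : ∀ i j, M.closer i < M.opener j ↔ r i < ℓ j
  closer_lt_closer : ∀ i j, M.closer i < M.closer j ↔ r i < r j ∨ r i = r j ∧ i < j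

namespace Represents

variable {M : Matching n} {ℓ r : Fin n → ℕ}

theorem opener_lt_closer (h : M.Represents ℓ r) (i j : Fin n) :
    M.opener i < M.closer j ↔ ℓ i ≤ r j := by
  rw [← not_lt, ← h.closer_lt_opener, not_lt]
  exact ⟨le_of_lt, fun hle => hle.lt_of_ne (M.opener_ne_closer i j)⟩

theorem unique {M' : Matching n} (h : M.Represents ℓ r) (h' : M'.Represents ℓ r) : M = M' := by
  refine eq_of_endpoints_eq
    (eq_of_bijective_of_lt_imp_lt M.endpoints_bijective M'.endpoints_bijective ?_)
  rintro (i | i) (j | j)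
  · simp [M.opener_strictMono.lt_iff_lt, M'.opener_strictMono.lt_iff_lt]
  · simp [h.opener_lt_closer, h'.opener_lt_closer]
  · simp [h.closer_lt_opener, h'.closer_lt_opener]
  · simp [h.closer_lt_closer, h'.closer_lt_closer]

theorem not_contains_patternP2 (h : M.Represents ℓ r) (hnc : IsNoncrossing ℓ r) :
    ¬ M.Contains patternP2 := by
  rw [contains_patternP2_iff]
  rintro ⟨a, b, c, d, -, hba, hac, hcb, hbd, hdc, -⟩
  rw [h.opener_lt_closer] at hba hcb hdc
  rw [h.closer_lt_opener] at hac hbd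
  exact (hnc b c (hba.trans_lt hac) hcb).not_gt (hbd.trans_le hdc)

theorem isNoncrossing (h : M.Represents ℓ r) (hlex : Monotone (leftKey ℓ r))
    (hle : ∀ i, ℓ i ≤ r i) (hl : ∀ i, ∃ k, ℓ k = r i) (hr : ∀ i, ∃ k, r k = ℓ i)
    (hP : ¬ M.Contains patternP2) : IsNoncrossing ℓ r := by
  intro b c hbc hcb
  by_contra! hlt
  obtain ⟨a, ha⟩ := hr b
  obtain ⟨d, hd⟩ := hl c
  have hla := hle a
  have hrd := hle d
  have hab : a < b := hlex.reflect_lt (leftKey_lt_leftKey_iff.2 ⟨by omega, by omega⟩)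
  have hcd : c < d := hlex.reflect_lt (leftKey_lt_leftKey_iff.2 ⟨by omega, by omega⟩)
  refine hP (M.contains_patternP2_iff.2 ⟨a, b, c, d, M.opener_strictMono hab, ?_⟩)
  simp only [h.opener_lt_closer, h.closer_lt_opener, h.closer_lt_closer]
  omega

theorem isStoimenow (h : M.Represents ℓ r) (hp : IsPointed Finset.univ ℓ r)
    (hlex : Monotone (leftKey ℓ r)) : M.IsStoimenow := by
  constructor
  · intro i j hadj hlt
    have hij : i < j := M.opener_strictMono.lt_iff_lt.1 (by omega)
    obtain ⟨hℓ, hr⟩ := leftKey_le_leftKey_iff.1 (hlex hij.le)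
    have hcc := (h.closer_lt_closer j i).1 hlt
    have hi := Finset.mem_univ i
    obtain ⟨k, -, -, hk⟩ := hp.exists_point i hi (ℓ i) (hp.le i hi)
    have hik := (h.opener_lt_closer i k).2 hk.ge
    have hkj := (h.closer_lt_opener k j).2 (by omega)
    omega
  · intro i j hadj hlt
    have hij : i < j := M.opener_strictMono.lt_iff_lt.1 hlt
    have hji : M.closer j < M.closer i := by omega
    have hr : r j < r i := by
      rcases (h.closer_lt_closer j i).1 hji with hr | hr
      · exact hr
      · exact absurd hr.2 hij.not_gt
    obtain ⟨k, -, hk, -⟩ := hp.exists_point i (Finset.mem_univ i) (r i) le_rfl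
    have hki := (h.opener_lt_closer k i).2 hk.le
    have hjk := (h.closer_lt_opener j k).2 (hk ▸ hr)
    omega

end Represents

/-- The key that sorts the endpoints of the intervals `[ℓ i, r i]` in the way required by
`Represents`, where `Sum.inl i` stands for the left and `Sum.inr i` for the right endpoint of the
`i`-th interval. -/
def endpointKey (ℓ r : Fin n → ℕ) (s : Fin n ⊕ Fin n) : ℕ ×ₗ (Fin n ⊕ₗ Fin n) :=
  toLex (Sum.elim ℓ r s, toLex s)

theorem endpointKey_injective (ℓ r : Fin n → ℕ) : Function.Injective (endpointKey ℓ r) :=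
  fun _ _ h => toLex.injective (congrArg (fun p => (ofLex p).2) h)

theorem endpointKey_lt_iff {ℓ r : Fin n → ℕ} {s t : Fin n ⊕ Fin n} :
    endpointKey ℓ r s < endpointKey ℓ r t ↔
      Sum.elim ℓ r s < Sum.elim ℓ r t ∨ Sum.elim ℓ r s = Sum.elim ℓ r t ∧ toLex s < toLex t :=
  Prod.Lex.toLex_lt_toLex

theorem exists_represents {ℓ r : Fin n → ℕ} (hle : ∀ i, ℓ i ≤ r i) (hℓ : Monotone ℓ) :
    ∃ M : Matching n, M.Represents ℓ r := by
  let e : Fin (2 * n) ≃ Fin n ⊕ Fin n := (finCongr (two_mul n)).trans finSumFinEquiv.symm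
  let τ : Equiv.Perm (Fin (2 * n)) := Tuple.sort (endpointKey ℓ r ∘ e)
  have hmono : StrictMono ((endpointKey ℓ r ∘ e) ∘ τ) :=
    (Tuple.monotone_sort _).strictMono_of_injective
      (((endpointKey_injective ℓ r).comp e.injective).comp τ.injective)
  let g : Fin n ⊕ Fin n ≃ Fin (2 * n) := e.symm.trans τ.symm
  have hg (s t) : g s < g t ↔ endpointKey ℓ r s < endpointKey ℓ r t := by
    simp [← hmono.lt_iff_lt, g]
  refine ⟨⟨g ∘ .inl, g ∘ .inr, fun i j hij => (hg _ _).2 (endpointKey_lt_iff.2 ?_),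
    fun i => (hg _ _).2 (endpointKey_lt_iff.2 ?_), ?_⟩, fun i j => ?_, fun i j => ?_⟩
  · simpa [hij, ← le_iff_lt_or_eq] using hℓ hij.le
  · simpa [← le_iff_lt_or_eq] using hle i
  · rw [Sum.elim_comp_inl_inr]
    exact g.bijective
  · simp [hg, endpointKey_lt_iff]
  · simp [hg, endpointKey_lt_iff]

/-- There is a closer of `M` at the point `q` and an opener at the point `q + 1`. -/
abbrev IsCut (M : Matching n) (q : ℕ) : Prop :=
  ∃ i j, (M.closer i : ℕ) = q ∧ (M.opener j : ℕ) = q + 1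

/-- Cut the points of `M` into blocks between each closer and an opener that follows it immediately;
this is the index of the block of the point `p`. -/
def blockIndex (M : Matching n) (p : ℕ) : ℕ :=
  Nat.count M.IsCut p

/-- The index of the block that contains the opener of the `i`-th arc. -/
def left (M : Matching n) (i : Fin n) : ℕ :=
  M.blockIndex (M.opener i)

/-- The index of the block that contains the closer of the `i`-th arc. -/
def right (M : Matching n) (i : Fin n) : ℕ :=
  M.blockIndex (M.closer i)

theorem blockIndex_monotone (M : Matching n) : Monotone M.blockIndex :=
  Nat.count_monotone _

theorem left_le_right (M : Matching n) (i : Fin n) : M.left i ≤ M.right i :=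
  M.blockIndex_monotone (M.opener_lt_closer i).le

theorem monotone_left (M : Matching n) : Monotone M.left := fun _ _ hij =>
  M.blockIndex_monotone (M.opener_strictMono.monotone hij)

theorem blockIndex_lt_blockIndex (M : Matching n) {p q : ℕ} {i j : Fin n} (hp : p ≤ M.closer i)
    (hij : M.closer i < M.opener j) (hq : M.opener j ≤ q) : M.blockIndex p < M.blockIndex q := by
  obtain ⟨c, hic, hcj, ⟨k, hk⟩, hc⟩ := exists_and_not_succ
    (p := fun q => ∃ k, (M.closer k : ℕ) = q) hij.le ⟨i, rfl⟩
    fun ⟨k, hk⟩ => M.opener_ne_closer j k (Fin.ext hk.symm)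
  have hcut : M.IsCut c := by
    rcases M.exists_opener_or_closer_eq (p := c + 1) (by omega) with ⟨w, hw⟩ | hw
    · exact ⟨k, w, hk, hw⟩
    · exact absurd hw hc
  exact (M.blockIndex_monotone (hp.trans hic)).trans_lt
    (Nat.count_strict_mono hcut (hcj.trans_le hq))

theorem closer_lt_opener_iff (M : Matching n) (i j : Fin n) :
    M.closer i < M.opener j ↔ M.right i < M.left j :=
  ⟨fun h => M.blockIndex_lt_blockIndex le_rfl h le_rfl, fun h => M.blockIndex_monotone.reflect_lt h⟩

theorem exists_right_eq (M : Matching n) {i : Fin n} {v : ℕ} (hv : v ≤ M.right i) :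
    ∃ k, M.right k = v := by
  rcases hv.eq_or_lt with rfl | hv
  · exact ⟨i, rfl⟩
  · obtain ⟨_, -, ⟨k, -, rfl, -⟩, hk⟩ := exists_count_eq_of_lt_count hv
    exact ⟨k, hk⟩

theorem exists_left_eq (M : Matching n) {i : Fin n} {v : ℕ} (hv : v ≤ M.right i) :
    ∃ k, M.left k = v := by
  rcases v with _ | v
  · have hn := i.pos
    rcases M.exists_opener_or_closer_eq (p := 0) (by omega) with ⟨k, hk⟩ | ⟨k, hk⟩
    · exact ⟨k, by rw [left, hk, blockIndex, Nat.count_zero]⟩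
    · have hlt := M.opener_lt_closer k
      omega
  · obtain ⟨c, -, hcut, hc⟩ := exists_count_eq_of_lt_count hv
    obtain ⟨-, k, -, hk⟩ := id hcut
    exact ⟨k, by rw [left, hk, blockIndex, Nat.count_succ, if_pos hcut, hc]⟩

namespace IsStoimenow

variable {M : Matching n} {i j : Fin n}

theorem closer_le_closer (hM : M.IsStoimenow) (hij : i ≤ j) (h : M.left i = M.left j) :
    M.closer i ≤ M.closer j := by
  refine le_of_forall_adjacent (f := fun k => (M.opener k : ℕ))
    (Fin.val_injective.comp M.opener_strictMono.injective)
    (fun k w hkw => not_lt.1 (hM.1 k w hkw)) (M.opener_strictMono.monotone hij)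
    fun q hiq hqj => ?_
  rcases M.exists_opener_or_closer_eq (p := q) (by omega) with hq | ⟨k, rfl⟩
  · exact hq
  · have hkj : M.closer k < M.opener j := lt_of_le_of_ne hqj (M.opener_ne_closer j k).symm
    exact absurd h (M.blockIndex_lt_blockIndex hiq hkj le_rfl).ne

theorem le_of_closer_le_closer (hM : M.IsStoimenow) (hij : M.closer i ≤ M.closer j)
    (h : M.right i = M.right j) : i ≤ j := by
  refine le_of_forall_adjacent (f := fun k => (M.closer k : ℕ)) (g := id)
    (Fin.val_injective.comp M.closer_injective)
    (fun k w hkw => M.opener_strictMono.le_iff_le.1 (not_lt.1 (hM.2 w k hkw))) hij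
    fun q hiq hqj => ?_
  rcases M.exists_opener_or_closer_eq (p := q) (by omega) with ⟨k, rfl⟩ | hq
  · have hik : M.closer i < M.opener k := lt_of_le_of_ne hiq (M.opener_ne_closer k i).symm
    exact absurd h (M.blockIndex_lt_blockIndex le_rfl hik hqj).ne
  · exact hq

theorem monotone_leftKey (hM : M.IsStoimenow) : Monotone (leftKey M.left M.right) :=
  fun _ _ hij => leftKey_le_leftKey_iff.2
    ⟨M.monotone_left hij, fun h => M.blockIndex_monotone (hM.closer_le_closer hij h)⟩

theorem represents (hM : M.IsStoimenow) : M.Represents M.left M.right where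
  closer_lt_opener := M.closer_lt_opener_iff
  closer_lt_closer i j := by
    constructor
    · intro hlt
      refine (M.blockIndex_monotone hlt.le).lt_or_eq.imp_right fun h => ⟨h, ?_⟩
      refine (hM.le_of_closer_le_closer hlt.le h).lt_of_ne ?_
      rintro rfl
      exact lt_irrefl _ hlt
    · rintro (h | ⟨h, hij⟩)
      · exact M.blockIndex_monotone.reflect_lt h
      · by_contra! hle
        exact hij.not_ge (hM.le_of_closer_le_closer hle h.symm)

theorem isNoncrossing (hM : M.IsStoimenow) (hP : ¬ M.Contains patternP2) :
    IsNoncrossing M.left M.right :=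
  hM.represents.isNoncrossing hM.monotone_leftKey M.left_le_right
    (fun _ => M.exists_left_eq le_rfl) (fun i => M.exists_right_eq (M.left_le_right i)) hP

theorem isPointed (hM : M.IsStoimenow) (hP : ¬ M.Contains patternP2) :
    IsPointed Finset.univ M.left M.right where
  le i _ := M.left_le_right i
  exists_point i _ j hj := by
    obtain ⟨x, rfl⟩ := M.exists_left_eq hj
    obtain ⟨y, hy⟩ := M.exists_right_eq hj
    obtain ⟨z, hz⟩ := (hM.isNoncrossing hP).exists_point M.left_le_right hy.symm
    exact ⟨z, Finset.mem_univ z, hz⟩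

end IsStoimenow

end Matching

/-! ### The map from matchings to sequences -/

namespace Matching

variable {n : ℕ}

theorem Represents.isPointedIntervalOrder {M : Matching n} {ℓ r : Fin n → ℕ}
    (h : M.Represents ℓ r) (hp : IsPointed Finset.univ ℓ r) :
    M.toPoset.IsPointedIntervalOrder ℓ r where
  toIsPointed := hp
  lt_iff i j := by simp [toPoset, h.closer_lt_opener]

theorem Represents.exists_Psi_eq {M : Matching n} {ℓ r : Fin n → ℕ} (h : M.Represents ℓ r)
    (hp : IsPointed Finset.univ ℓ r) :
    ∃ σ : Equiv.Perm (Fin n), Monotone (rightKey ℓ r ∘ σ) ∧ M.Psi = ℓ ∘ σ := by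
  obtain ⟨σ, hinj, -, hsort, hseq⟩ := (h.isPointedIntervalOrder hp).exists_toSeq_eq
    (Finset.card_fin n)
  exact ⟨Equiv.ofBijective σ (Finite.injective_iff_bijective.1 hinj), hsort, hseq⟩

theorem IsStoimenow.isRGF_Psi {M : Matching n} (hM : M.IsStoimenow)
    (hP : ¬ M.Contains patternP2) : IsRGF M.Psi ∧ ¬ ContainsPattern M.Psi ![1, 0, 1] := by
  obtain ⟨σ, hsort, hΨ⟩ := hM.represents.exists_Psi_eq (hM.isPointed hP)
  rw [hΨ]
  exact ⟨((hM.isPointed hP).comp_perm σ).isRGF (monotone_of_monotone_rightKey hsort),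
    ((hM.isNoncrossing hP).comp σ).not_containsPattern_101 (fun i => M.left_le_right (σ i)) hsort⟩

theorem IsStoimenow.eq_of_Psi_eq {M M' : Matching n} (hM : M.IsStoimenow)
    (hP : ¬ M.Contains patternP2) (hM' : M'.IsStoimenow) (hP' : ¬ M'.Contains patternP2)
    (h : M.Psi = M'.Psi) : M = M' := by
  obtain ⟨σ, hsort, hΨ⟩ := hM.represents.exists_Psi_eq (hM.isPointed hP)
  obtain ⟨σ', hsort', hΨ'⟩ := hM'.represents.exists_Psi_eq (hM'.isPointed hP')
  rw [hΨ, hΨ'] at h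
  obtain ⟨hleft, hright⟩ := (hM.isPointed hP).eq_of_comp_eq hM.monotone_leftKey hsort
    (hM'.isPointed hP') hM'.monotone_leftKey hsort' h
  exact hM.represents.unique (hleft ▸ hright ▸ hM'.represents)

theorem exists_Psi_eq_of_isRGF {α : Fin n → ℕ} (hα : IsRGF α)
    (h101 : ¬ ContainsPattern α ![1, 0, 1]) :
    ∃ M : Matching n, M.IsStoimenow ∧ ¬ M.Contains patternP2 ∧ M.Psi = α := by
  let τ := Tuple.sort (leftKey α (partialSups α))
  have hlex : Monotone (leftKey (α ∘ τ) (partialSups α ∘ τ)) :=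
    Tuple.monotone_sort (leftKey α (partialSups α))
  have hp := hα.isPointed.comp_perm τ
  obtain ⟨M, hM⟩ := exists_represents (fun i => hp.le i (Finset.mem_univ i))
    (Prod.Lex.monotone_fst_ofLex.comp hlex)
  obtain ⟨σ, hsort, hΨ⟩ := hM.exists_Psi_eq hp
  have hkey : rightKey α (partialSups α) ∘ (σ.trans τ) = rightKey α (partialSups α) :=
    Tuple.unique_monotone (τ := Equiv.refl _) hsort (hα.monotone_rightKey h101)
  refine ⟨M, hM.isStoimenow hp hlex,
    hM.not_contains_patternP2 ((hα.isNoncrossing h101).comp τ), hΨ.trans ?_⟩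
  exact funext fun i => congrArg (fun p => OrderDual.ofDual (ofLex p).2) (congrFun hkey i)

theorem Psi_bijOn (n : ℕ) :
    Set.BijOn (Psi (n := n)) {M | M.IsStoimenow ∧ ¬ M.Contains patternP2}
      {α | IsRGF α ∧ ¬ ContainsPattern α ![1, 0, 1]} := by
  refine ⟨fun M hM => hM.1.isRGF_Psi hM.2,
    fun M hM M' hM' h => hM.1.eq_of_Psi_eq hM.2 hM'.1 hM'.2 h, fun α hα => ?_⟩
  obtain ⟨M, hM, hP, hΨ⟩ := exists_Psi_eq_of_isRGF hα.1 hα.2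
  exact ⟨M, ⟨hM, hP⟩, hΨ⟩

end Matching

theorem Upsilon_bijOn (n : ℕ) :
    Set.BijOn (Upsilon (n := n)) {M | M.IsStoimenow ∧ ¬ M.Contains Matching.patternP2}
      {π | IsFishburn π ∧ ¬ ContainsPattern π ![3, 1, 4, 2]} := by
  refine ((transposition_bijOn n).comp (Matching.Psi_bijOn n)).congr fun M hM => ?_
  obtain ⟨hα, h101⟩ := (Matching.Psi_bijOn n).mapsTo hM
  have hΔ : Delta M.Psi = M.Psi := hα.Delta_eq_self (mt (containsPattern_101_of_0101 _) h101)
  rw [Upsilon, hΔ, Function.comp_apply]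

end Fishburn

theorem mainTheorem10 (n : ℕ) :
    Set.BijOn (Fishburn.Upsilon (n := n))
      {M : Fishburn.Matching n | M.IsStoimenow ∧ ¬ M.Contains Fishburn.Matching.patternP2}
      {π : Equiv.Perm (Fin n) |
        Fishburn.IsFishburn π ∧ ¬ Fishburn.ContainsPattern π ![3, 1, 4, 2]} ∧
    (∀ α : Fin n → ℕ, Fishburn.IsAscentSeq α →
      (¬ Fishburn.ContainsPattern α ![0, 1, 0, 1] ↔ ¬ Fishburn.ContainsPattern α ![1, 0, 1])) ∧
    (∀ α : Fin n → ℕ, Fishburn.IsAscentSeq α → ¬ Fishburn.ContainsPattern α ![0, 1, 0, 1] →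
      Fishburn.Delta α = α) :=
  ⟨Fishburn.Upsilon_bijOn n, fun _ hα => not_congr hα.containsPattern_0101_iff,
    fun _ hα h => (hα.isRGF h).Delta_eq_self h⟩
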